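/- **Conventions.** $\|\cdot\|$ is the Euclidean norm on $\mathbb{R}^n$. For $h:\mathbb{R}^n\to[-\infty,\infty]$ let $\operatorname{dom}h=\{x: h(x)<\infty\}$; $h$ is proper if it never equals $-\infty$ and $\operatorname{dom}h\neq\emptyset$, and a proper function is closed if it is lower semicontinuous. For $x\in\operatorname{dom}h$ put $$\widehat\partial h(x)=\Big\{v:\ \liminf_{y\to x,\,y\ne x}\frac{h(y)-h(x)-\langle v,y-x\rangle}{\|y-x\|}\ge 0\Big\},$$ $$\partial h(x)=\{v:\ \exists\, x^k\to x \text{ with } h(x^k)\to h(x),\ v^k\in\widehat\partial h(x^k),\ v^k\to v\},$$ and $\partial h(x)=\emptyset$ for $x\notin\operatorname{dom}h$ (for convex $h$, $\partial h$ is the usual convex subdifferential). Let $\operatorname{dom}\partial h=\{x:\partial h(x)\ne\emptyset\}$, $(\partial h)^{-1}(\zeta)=\{x:\zeta\in\partial h(x)\}$, and let $\mathrm{d}(\cdot,C)$ be the Euclidean distance to $C$, with $\mathrm{d}(\cdot,\emptyset)=\infty$. A polyhedron is an intersection of finitely many closed half-spaces (possibly empty). A proper closed function $f$ is a *KL function with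 exponent $\alpha\in[0,1)$* if for every $\hat x\in\operatorname{dom}\partial f$ there are $a\in(0,\infty]$, $a_0>0$ and a neighbourhood $V$ of $\hat x$ such that, with $\phi(\nu)=a_0\nu^{1-\alpha}$, $$\phi'(f(x)-f(\hat x))\;\mathrm{d}(0,\partial f(x))\ge 1\qquad\text{for all }x\in V\text{ with }f(\hat x)<f(x)<f(\hat x)+a.$$ **Theorem.** Let $h=\|\cdot\|+\kappa$ on $\mathbb{R}^n$, where $\kappa:\mathbb{R}^n\to[0,\infty]$ is a closed gauge, i.e. a nonnegative, positively homogeneous, closed convex function with $\kappa(0)=0$. Then: (i) For every $\zeta\in\mathbb{R}^n$ the set $(\partial h)^{-1}(\zeta)$ is a polyhedron. (ii) For every $x\in\operatorname{dom}\partial h$ and every $\zeta\in\partial h(x)$, the mapping $\partial h$ is metrically subregular at $x$ for $\zeta$: there are $\eta,\rho>0$ such that $$\mathrm{d}\big(y,(\partial h)^{-1}(\zeta)\big)\le\eta\,\mathrm{d}\big(\zeta,\partial h(y)\big)\qquad\text{whenever }\|y-x\|\le\rho.$$ (iii) Let $A_1\in\mathbb{R}^{s_1\times n}$, and let $q_1:\mathbb{R}^{s_1}\to\mathbb{R}$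 be twice continuously differentiable, bounded below, and strongly convex on every compact convex set (with a modulus that may depend on the set). Suppose that there is $x^\circ\in\operatorname{dom}h$ with $q_1(A_1x^\circ)<0$, and that the origin is not feasible, i.e. it does not belong to $\{x\in\operatorname{dom}h: q_1(A_1x)\le 0\}$. Then the function $$F(x)=\begin{cases}h(x) & \text{if } q_1(A_1x)\le 0,\\ \infty &\text{otherwise,}\end{cases}$$ is a KL function with exponent $\tfrac12$. -/

import Mathlib

open Filter Topology
open scoped ENNReal

namespace KLExp

/-- Euclidean space of dimension `n`. -/
abbrev E (n : ℕ) : Type := EuclideanSpace ℝ (Fin n)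

/-! ### Extended-real-valued functions -/

/-- The domain of an extended-real-valued function. -/
def dom {n : ℕ} (h : E n → EReal) : Set (E n) := {x | h x < ⊤}

/-- A function is proper if it never takes the value `-∞` and its domain is nonempty. -/
def IsProper {n : ℕ} (h : E n → EReal) : Prop :=
  (∀ x, ⊥ < h x) ∧ (dom h).Nonempty

/-- A proper function is closed if it is lower semicontinuous. -/
def IsProperClosed {n : ℕ} (h : E n → EReal) : Prop :=
  IsProper h ∧ LowerSemicontinuous h

/-- Convexity of an extended-real-valued function: its epigraph is convex. -/
def IsConvex {n : ℕ} (h : E n → EReal) : Prop :=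
  Convex ℝ {p : E n × ℝ | h p.1 ≤ (p.2 : EReal)}

open Classical in
/-- The indicator function of a set: `0` on the set and `+∞` off it. -/
noncomputable def indicatorFn {n : ℕ} (C : Set (E n)) (x : E n) : EReal :=
  if x ∈ C then 0 else ⊤

/-! ### Subdifferentials -/

/-- The regular subdifferential
`{v | liminf_{y → x, y ≠ x} (h y - h x - ⟪v, y - x⟫) / ‖y - x‖ ≥ 0}` at `x ∈ dom h`
(empty if `x ∉ dom h`). -/
noncomputable def regularSubdiff {n : ℕ} (h : E n → EReal) (x : E n) : Set (E n) :=
  {v | x ∈ dom h ∧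
    0 ≤ liminf (fun y : E n =>
      (h y - h x - ((inner ℝ v (y - x) : ℝ) : EReal)) / ((‖y - x‖ : ℝ) : EReal)) (𝓝[≠] x)}

/-- The (limiting) subdifferential at `x ∈ dom h` (empty if `x ∉ dom h`). -/
noncomputable def subdiff {n : ℕ} (h : E n → EReal) (x : E n) : Set (E n) :=
  {v | x ∈ dom h ∧ ∃ (xs vs : ℕ → E n),
    Tendsto xs atTop (𝓝 x) ∧ Tendsto (fun k => h (xs k)) atTop (𝓝 (h x)) ∧
    (∀ k, vs k ∈ regularSubdiff h (xs k)) ∧ Tendsto vs atTop (𝓝 v)}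

/-! ### Set-valued mappings -/

/-- The value of the inverse of a set-valued mapping at `y`. -/
def setInv {n : ℕ} (S : E n → Set (E n)) (y : E n) : Set (E n) := {x | y ∈ S x}

/-- The domain of a set-valued mapping. -/
def setDom {n : ℕ} (S : E n → Set (E n)) : Set (E n) := {x | (S x).Nonempty}

/-- Metric subregularity of `S` at `xbar` for `ybar`. The distance to the empty set is `∞`. -/
def MetricSubregularAt {n : ℕ} (S : E n → Set (E n)) (xbar ybar : E n) : Prop :=
  ybar ∈ S xbar ∧ ∃ η ρ : ℝ, 0 < η ∧ 0 < ρ ∧ ∀ x ∈ Metric.closedBall xbar ρ,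
    Metric.infEDist x (setInv S ybar) ≤ ENNReal.ofReal η * Metric.infEDist ybar (S x)

/-- A polyhedron: an intersection of finitely many closed half-spaces. -/
def IsPolyhedron {n : ℕ} (P : Set (E n)) : Prop :=
  ∃ (m : ℕ) (a : Fin m → E n) (b : Fin m → ℝ), P = {x | ∀ i, inner ℝ (a i) x ≤ b i}

/-! ### The Kurdyka–Łojasiewicz property -/

/-- `φ : [0, a) → [0, ∞)` is continuous and concave with `φ 0 = 0`, and is continuously
differentiable with positive derivative on `(0, a)`; here `a ∈ (0, ∞]`. -/
def IsDesingularizing (a : EReal) (φ : ℝ → ℝ) : Prop :=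
  φ 0 = 0 ∧
  (∀ t : ℝ, 0 ≤ t → (t : EReal) < a → 0 ≤ φ t) ∧
  ContinuousOn φ {t : ℝ | 0 ≤ t ∧ (t : EReal) < a} ∧
  ConcaveOn ℝ {t : ℝ | 0 ≤ t ∧ (t : EReal) < a} φ ∧
  ContDiffOn ℝ 1 φ {t : ℝ | 0 < t ∧ (t : EReal) < a} ∧
  ∀ t : ℝ, 0 < t → (t : EReal) < a → 0 < deriv φ t

/-- The KL property of `h` at `xhat` with the desingularizing function `φ` on `[0, a)`. The
distance from `0` to an empty subdifferential is `∞`. -/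
def KLPropertyWith {n : ℕ} (h : E n → EReal) (xhat : E n) (a : EReal) (φ : ℝ → ℝ) : Prop :=
  0 < a ∧ IsDesingularizing a φ ∧ ∃ V ∈ 𝓝 xhat, ∀ x ∈ V, h xhat < h x → h x < h xhat + a →
    1 ≤ ENNReal.ofReal (deriv φ (h x - h xhat).toReal) * Metric.infEDist 0 (subdiff h x)

/-- The KL property at `xhat` with exponent `α ∈ [0, 1)`: the desingularizing function can be
chosen as `φ ν = a₀ ν ^ (1 - α)` with `a₀ > 0`. -/
def KLPropertyExponent {n : ℕ} (h : E n → EReal) (xhat : E n) (α : ℝ) : Prop :=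
  0 ≤ α ∧ α < 1 ∧ ∃ (a : EReal) (a₀ : ℝ), 0 < a₀ ∧
    KLPropertyWith h xhat a (fun ν : ℝ => a₀ * ν ^ (1 - α))

/-- A KL function with exponent `α`. -/
def IsKLFunctionExponent {n : ℕ} (h : E n → EReal) (α : ℝ) : Prop :=
  IsProperClosed h ∧ ∀ xhat ∈ setDom (subdiff h), KLPropertyExponent h xhat α

/-! ### Gauges and the constrained problem -/

/-- A closed gauge: a nonnegative, positively homogeneous, closed convex function that vanishes
at the origin. -/
structure IsClosedGauge {n : ℕ} (κ : E n → EReal) : Prop where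
  nonneg : ∀ x, 0 ≤ κ x
  zero : κ 0 = 0
  pos_hom : ∀ (t : ℝ) (x : E n), 0 < t → κ (t • x) = (t : EReal) * κ x
  convex : IsConvex κ
  closed : IsProperClosed κ

/-- The function `x ↦ ‖x‖ + κ x`. -/
noncomputable def normAdd {n : ℕ} (κ : E n → EReal) (x : E n) : EReal :=
  ((‖x‖ : ℝ) : EReal) + κ x

/-- The set of solutions of the constraint `q (A x) ≤ 0`. -/
def constraintSet {n s : ℕ} (q : E s → ℝ) (A : Matrix (Fin s) (Fin n) ℝ) : Set (E n) :=
  {x | q (Matrix.toEuclideanLin A x) ≤ 0}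

/-- The objective `F x = h x + δ_{q (A ·) ≤ 0} x` of the constrained problem. -/
noncomputable def constrainedFn {n s : ℕ} (h : E n → EReal) (q : E s → ℝ)
    (A : Matrix (Fin s) (Fin n) ℝ) (x : E n) : EReal :=
  h x + indicatorFn (constraintSet q A) x

/-- `q` is strongly convex on every compact convex set (the modulus may depend on the set). -/
def StronglyConvexOnCompacts {s : ℕ} (q : E s → ℝ) : Prop :=
  ∀ C : Set (E s), IsCompact C → Convex ℝ C → ∃ σ : ℝ, 0 < σ ∧ StrongConvexOn C σ q

end KLExp

namespace KLExp

/-! ### Convex subgradients -/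

/-! The sum `h = ‖·‖ + κ` is itself a closed gauge, so `v ∈ ∂h x` means that `⟪v, ·⟫` is a linear
minorant of `h` that is tight at `x`. If `x ≠ 0`, the norm is differentiable at `x`. With `u = x /
‖x‖`, this yields `h y - ⟪v, y⟫ ≥ ‖y‖ - ⟪u, y⟫` for all `y` (`norm_sub_inner_le_of_mem_subdiff`).
Everything rests on this inequality.

Equality in Cauchy–Schwarz then makes `(∂h)⁻¹ ζ` a ray as soon as it contains a nonzero point;
otherwise it is `{0}` or empty. For subregularity, `‖y‖ - ⟪u, y⟫` dominates the squared distance to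
the ray, locally up to a constant, while monotonicity of `∂h` bounds `h y - ⟪ζ, y⟫` by `‖v - ζ‖`
times that distance.

For `F`, which is convex, points that do not minimize are easy: subgradients at nearby higher values
stay away from `0`. At a minimizer it suffices to have quadratic growth (`exists_growth_of_isMin`).
Slater's condition gives a multiplier `μ`. Since the origin is infeasible, `μ > 0` and the
constraint is active. Strong convexity of `q` then adds a multiple of `‖T (y - x)‖ ^ 2` to `‖y‖ -
⟪u, y⟫`, where `T` is the linear map of `A`. The second term controls the distance to the ray; the
first controls the position along it, because `T u ≠ 0`. -/

/-- The affine function with slope `v` through `(x, h x)` minorizes `h`. -/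
def IsConvexSubgradient {n : ℕ} (h : E n → EReal) (x v : E n) : Prop :=
  ∃ a : ℝ, h x = a ∧ ∀ (y : E n) (b : ℝ), h y ≤ b → a + inner ℝ v (y - x) ≤ b

theorem exists_coe_of_mem_dom {n : ℕ} {h : E n → EReal} (hbot : ∀ x, ⊥ < h x) {x : E n}
    (hx : x ∈ dom h) : ∃ a : ℝ, h x = a :=
  ⟨(h x).toReal, (EReal.coe_toReal (ne_of_lt hx) (hbot x).ne').symm⟩

theorem exists_coe_of_le_coe {n : ℕ} {h : E n → EReal} (hbot : ∀ x, ⊥ < h x) {x : E n} {b : ℝ}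
    (hx : h x ≤ b) : ∃ a : ℝ, h x = a :=
  exists_coe_of_mem_dom hbot (lt_of_le_of_lt hx (EReal.coe_lt_top b) : h x < ⊤)

theorem IsConvex.combo_le {n : ℕ} {h : E n → EReal} (hc : IsConvex h) {x y : E n} {a b s t : ℝ}
    (hx : h x ≤ a) (hy : h y ≤ b) (hs : 0 ≤ s) (ht : 0 ≤ t) (hst : s + t = 1) :
    h (s • x + t • y) ≤ ((s * a + t * b : ℝ) : EReal) :=
  hc (x := (x, a)) (y := (y, b)) hx hy hs ht hst

theorem IsConvex.line_le {n : ℕ} {h : E n → EReal} (hc : IsConvex h) {x y : E n} {a b t : ℝ}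
    (hx : h x ≤ a) (hy : h y ≤ b) (ht : 0 ≤ t) (ht1 : t ≤ 1) :
    h (x + t • (y - x)) ≤ ((a + t * (b - a) : ℝ) : EReal) := by
  have := hc.combo_le hx hy (sub_nonneg.2 ht1) ht (by ring)
  convert this using 2
  · module
  · ring

theorem isConvex_of_combo_le {n : ℕ} {h : E n → EReal}
    (H : ∀ (x y : E n) (a b s t : ℝ), h x ≤ a → h y ≤ b → 0 ≤ s → 0 ≤ t → s + t = 1 →
      h (s • x + t • y) ≤ ((s * a + t * b : ℝ) : EReal)) : IsConvex h := by
  intro p hp r hr s t hs ht hst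
  exact H p.1 r.1 p.2 r.2 s t hp hr hs ht hst

theorem IsConvexSubgradient.mem_dom {n : ℕ} {h : E n → EReal} {x v : E n}
    (hv : IsConvexSubgradient h x v) : x ∈ dom h := by
  obtain ⟨a, ha, -⟩ := hv
  simp [dom, ha]

theorem IsConvexSubgradient.mem_regularSubdiff {n : ℕ} {h : E n → EReal} {x v : E n}
    (hbot : ∀ x, ⊥ < h x) (hv : IsConvexSubgradient h x v) : v ∈ regularSubdiff h x := by
  refine ⟨hv.mem_dom, ?_⟩
  obtain ⟨a, ha, H⟩ := hv
  refine le_liminf_of_le (by isBoundedDefault) (Eventually.of_forall fun y => ?_)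
  refine EReal.div_nonneg ?_ (EReal.coe_nonneg.2 (norm_nonneg _))
  rw [ha]
  rcases eq_or_ne (h y) ⊤ with hy | hy
  · simp [hy]
  · obtain ⟨b, hb⟩ := exists_coe_of_mem_dom hbot (lt_top_iff_ne_top.2 hy)
    have := H y b hb.le
    rw [hb]
    have h2 : (0 : ℝ) ≤ b - a - inner ℝ v (y - x) := by linarith
    exact_mod_cast h2

/-- If the affine minorant failed at `y`, convexity would keep the difference quotients along the
segment from `x` to `y` below a fixed negative number, against the liminf condition. -/
theorem isConvexSubgradient_of_mem_regularSubdiff {n : ℕ} {h : E n → EReal} {x v : E n}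
    (hbot : ∀ x, ⊥ < h x) (hc : IsConvex h) (hv : v ∈ regularSubdiff h x) :
    IsConvexSubgradient h x v := by
  obtain ⟨hx, hv⟩ := hv
  obtain ⟨a, ha⟩ := exists_coe_of_mem_dom hbot hx
  refine ⟨a, ha, fun y b hb => ?_⟩
  rcases eq_or_ne y x with rfl | hyx
  · rw [ha] at hb
    simpa using EReal.coe_le_coe_iff.1 hb
  by_contra hlt
  push Not at hlt
  have hd : 0 < ‖y - x‖ := norm_pos_iff.2 (sub_ne_zero.2 hyx)
  set g : ℝ := inner ℝ v (y - x) with hg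
  -- Half the slope deficit: along the segment the quotients are at most `-2ε`, while the liminf
  -- condition makes them eventually exceed `-ε`.
  set ε : ℝ := (a + g - b) / (2 * ‖y - x‖) with hε
  have hεpos : 0 < ε := by
    apply div_pos <;> linarith
  have h1 : ((-ε : ℝ) : EReal) < liminf (fun y : E n =>
      (h y - h x - ((inner ℝ v (y - x) : ℝ) : EReal)) / ((‖y - x‖ : ℝ) : EReal)) (𝓝[≠] x) :=
    lt_of_lt_of_le (by exact_mod_cast neg_lt_zero.2 hεpos) hv
  have h2 := eventually_lt_of_lt_liminf h1
  have h3 : Tendsto (fun t : ℝ => x + t • (y - x)) (𝓝[>] 0) (𝓝[≠] x) := by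
    refine tendsto_nhdsWithin_iff.2 ⟨?_, ?_⟩
    · have : Continuous (fun t : ℝ => x + t • (y - x)) := by fun_prop
      simpa using (this.tendsto 0).mono_left nhdsWithin_le_nhds
    · filter_upwards [self_mem_nhdsWithin] with t ht
      simp [ne_of_gt (Set.mem_Ioi.1 ht), sub_ne_zero.2 hyx]
  obtain ⟨t, ht, ht0, ht1⟩ := ((h3.eventually h2).and
    (Ioo_mem_nhdsGT (zero_lt_one : (0 : ℝ) < 1))).exists
  have hle := hc.line_le ha.le hb ht0.le ht1.le
  have hn : ‖x + t • (y - x) - x‖ = t * ‖y - x‖ := by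
    simp [norm_smul, abs_of_pos ht0]
  have hi : inner ℝ v (x + t • (y - x) - x) = t * g := by
    simp [inner_smul_right, hg]
  rw [hn, hi, ha] at ht
  have h4 : ((-ε : ℝ) : EReal) <
      (((a + t * (b - a) - a - t * g) / (t * ‖y - x‖) : ℝ) : EReal) := by
    refine ht.trans_le ?_
    rw [EReal.coe_div]
    refine EReal.div_le_div_right_of_nonneg (by exact_mod_cast by positivity) ?_
    rw [EReal.coe_sub, EReal.coe_sub]
    exact EReal.sub_le_sub (EReal.sub_le_sub hle le_rfl) le_rfl
  have h5 := EReal.coe_lt_coe_iff.1 h4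
  have h6 : (a + t * (b - a) - a - t * g) / (t * ‖y - x‖) = -(2 * ε) := by
    rw [hε]; field_simp; ring
  rw [h6] at h5
  linarith

/-- For a convex function that never takes the value `-∞`, the limiting subdifferential is the
subdifferential of convex analysis. -/
theorem mem_subdiff_iff {n : ℕ} {h : E n → EReal} {x v : E n}
    (hbot : ∀ x, ⊥ < h x) (hc : IsConvex h) :
    v ∈ subdiff h x ↔ IsConvexSubgradient h x v := by
  constructor
  · rintro ⟨hx, xs, vs, hxs, hhs, hvs, hv⟩
    obtain ⟨a, ha⟩ := exists_coe_of_mem_dom hbot hx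
    refine ⟨a, ha, fun y b hb => ?_⟩
    have H : ∀ k, (h (xs k)).toReal + inner ℝ (vs k) (y - xs k) ≤ b := by
      intro k
      obtain ⟨c, hck, H⟩ := isConvexSubgradient_of_mem_regularSubdiff hbot hc (hvs k)
      simpa [hck] using H y b hb
    have h1 : Tendsto (fun k => (h (xs k)).toReal) atTop (𝓝 a) := by
      have := (EReal.tendsto_toReal (a := h x) (by simp [ha]) (by simp [ha])).comp hhs
      simpa [ha, Function.comp_def] using this
    have h2 : Tendsto (fun k => inner ℝ (vs k) (y - xs k)) atTop (𝓝 (inner ℝ v (y - x))) :=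
      hv.inner (tendsto_const_nhds.sub hxs)
    exact le_of_tendsto (h1.add h2) (Eventually.of_forall H)
  · intro hv
    exact ⟨hv.mem_dom, fun _ => x, fun _ => v, tendsto_const_nhds, tendsto_const_nhds,
      fun _ => hv.mem_regularSubdiff hbot, tendsto_const_nhds⟩

/-! ### Gauges -/

namespace IsClosedGauge

variable {n : ℕ} {κ : E n → EReal}

theorem bot_lt (hκ : IsClosedGauge κ) (x : E n) : ⊥ < κ x :=
  EReal.bot_lt_zero.trans_le (hκ.nonneg x)

theorem smul_le (hκ : IsClosedGauge κ) {x : E n} {a t : ℝ} (ht : 0 ≤ t) (hx : κ x ≤ a) :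
    κ (t • x) ≤ ((t * a : ℝ) : EReal) := by
  rcases ht.eq_or_lt with rfl | ht
  · simp [hκ.zero]
  · rw [hκ.pos_hom t x ht, EReal.coe_mul]
    exact mul_le_mul_of_nonneg_left hx (EReal.coe_nonneg.2 ht.le)

theorem add_le (hκ : IsClosedGauge κ) {x y : E n} {a b : ℝ} (hx : κ x ≤ a) (hy : κ y ≤ b) :
    κ (x + y) ≤ ((a + b : ℝ) : EReal) := by
  have := hκ.smul_le (t := 2) (by norm_num)
    (hκ.convex.combo_le (s := 1 / 2) (t := 1 / 2) hx hy (by norm_num) (by norm_num) (by norm_num))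
  convert this using 2
  · module
  · ring

/-- The subgradients of a gauge at `x` are the linear minorants of the gauge that are tight
at `x`. -/
theorem mem_subdiff_iff (hκ : IsClosedGauge κ) {x v : E n} :
    v ∈ subdiff κ x ↔
      κ x = ((inner ℝ v x : ℝ) : EReal) ∧ ∀ (y : E n) (b : ℝ), κ y ≤ b → inner ℝ v y ≤ b := by
  rw [KLExp.mem_subdiff_iff hκ.bot_lt hκ.convex]
  constructor
  · rintro ⟨a, ha, H⟩
    -- Testing at `0` and at `2x` gives both inequalities between `a` and `⟪v, x⟫`.
    have h0 := H 0 0 (by simp [hκ.zero])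
    have h2 := H ((2 : ℝ) • x) (2 * a) (hκ.smul_le (by norm_num) ha.le)
    simp only [inner_sub_right, inner_smul_right, inner_zero_right] at h0 h2
    have hax : a = inner ℝ v x := by linarith
    refine ⟨by rw [ha, hax], fun y b hb => ?_⟩
    have h3 := H (x + y) (a + b) (hκ.add_le ha.le hb)
    rw [add_sub_cancel_left] at h3
    linarith
  · rintro ⟨hx, H⟩
    refine ⟨_, hx, fun y b hb => ?_⟩
    have := H y b hb
    rw [inner_sub_right]
    linarith

end IsClosedGauge

/-! ### The function `‖x‖ + κ x` -/

theorem normAdd_le_iff {n : ℕ} {κ : E n → EReal} {x : E n} {b : ℝ} :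
    normAdd κ x ≤ b ↔ κ x ≤ ((b - ‖x‖ : ℝ) : EReal) := by
  unfold normAdd
  rw [EReal.coe_sub, EReal.le_sub_iff_add_le (by simp) (by simp), add_comm]

theorem lowerSemicontinuous_coe_add {n : ℕ} {f : E n → EReal} (hf : LowerSemicontinuous f)
    {g : E n → ℝ} (hg : Continuous g) : LowerSemicontinuous fun x => ((g x : ℝ) : EReal) + f x :=
  LowerSemicontinuous.add' (continuous_coe_real_ereal.comp hg).lowerSemicontinuous hf
    fun _ => EReal.continuousAt_add (by simp) (by simp)

theorem isClosedGauge_normAdd {n : ℕ} {κ : E n → EReal} (hκ : IsClosedGauge κ) :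
    IsClosedGauge (normAdd κ) where
  nonneg x := add_nonneg (EReal.coe_nonneg.2 (norm_nonneg x)) (hκ.nonneg x)
  zero := by simp [normAdd, hκ.zero]
  pos_hom t x ht := by
    unfold normAdd
    rw [hκ.pos_hom t x ht, EReal.left_distrib_of_nonneg (EReal.coe_nonneg.2 (norm_nonneg x))
      (hκ.nonneg x), norm_smul, Real.norm_of_nonneg ht.le, EReal.coe_mul]
  convex := by
    refine isConvex_of_combo_le fun x y a b s t hx hy hs ht hst => ?_
    rw [normAdd_le_iff] at *
    refine (hκ.convex.combo_le hx hy hs ht hst).trans (EReal.coe_le_coe_iff.2 ?_)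
    have := norm_add_le (s • x) (t • y)
    rw [norm_smul, norm_smul, Real.norm_of_nonneg hs, Real.norm_of_nonneg ht] at this
    linarith
  closed := by
    refine ⟨⟨fun x => ?_, 0, ?_⟩, lowerSemicontinuous_coe_add hκ.closed.2 continuous_norm⟩
    · exact EReal.bot_lt_add_iff.2 ⟨EReal.bot_lt_coe _, hκ.bot_lt x⟩
    · simp [dom, normAdd, hκ.zero]

/-- If `t * c + f t ≥ f 0` for small positive `t`, then `c` plus the derivative of `f` at `0` is
nonnegative. -/
theorem nonneg_add_deriv_of_le {f : ℝ → ℝ} {c d : ℝ} (hf : HasDerivAt f d 0)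
    (H : ∀ t : ℝ, 0 < t → t ≤ 1 → f 0 ≤ t * c + f t) : 0 ≤ c + d := by
  have h1 : Tendsto (fun t : ℝ => c + t⁻¹ * (f t - f 0)) (𝓝[>] 0) (𝓝 (c + d)) := by
    have := hf.tendsto_slope_zero_right
    simp only [zero_add, smul_eq_mul] at this
    exact tendsto_const_nhds.add this
  refine ge_of_tendsto h1 ?_
  filter_upwards [Ioo_mem_nhdsGT (zero_lt_one : (0 : ℝ) < 1)] with t ht
  have h2 := H t ht.1 ht.2.le
  have h3 : c + t⁻¹ * (f t - f 0) = t⁻¹ * (t * c + f t - f 0) := by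
    have := ht.1.ne'
    field_simp
    ring
  rw [h3]
  exact mul_nonneg (inv_nonneg.2 ht.1.le) (by linarith)

/-- Growth of `‖·‖ + κ` above a linear minorant that is tight at a nonzero point. -/
theorem norm_sub_inner_le_of_mem_subdiff {n : ℕ} {κ : E n → EReal} (hκ : IsClosedGauge κ)
    {x v : E n} (hx : x ≠ 0) (hv : v ∈ subdiff (normAdd κ) x) {y : E n} {b : ℝ}
    (hy : normAdd κ y ≤ b) :
    ‖y‖ - inner ℝ (‖x‖⁻¹ • x) y ≤ b - inner ℝ v y := by
  obtain ⟨hvx, H⟩ := (isClosedGauge_normAdd hκ).mem_subdiff_iff.1 hv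
  rw [normAdd_le_iff] at hy
  have hx' := normAdd_le_iff.1 hvx.le
  have hd : HasDerivAt (fun t : ℝ => ‖x + t • y‖) (inner ℝ (‖x‖⁻¹ • x) y) 0 := by
    have h1 : HasDerivAt (fun t : ℝ => x + t • y) y 0 := by
      simpa using ((hasDerivAt_id (0 : ℝ)).smul_const y).const_add x
    have h2 := (h1.norm_sq).sqrt (by simpa using hx)
    have h3 : (fun t : ℝ => √(‖x + t • y‖ ^ 2)) = fun t => ‖x + t • y‖ := by
      ext t; exact Real.sqrt_sq (norm_nonneg _)
    rw [h3] at h2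
    convert h2 using 1
    simp [real_inner_smul_left]
    field_simp
  -- Only `κ` is estimated by subadditivity along `x + t • y`; the norm is kept exact, so that its
  -- derivative at `x` survives in the limit `t → 0`.
  have key := nonneg_add_deriv_of_le (c := b - ‖y‖ - inner ℝ v y) hd ?_
  · linarith
  intro t ht _
  have h1 : normAdd κ (x + t • y) ≤
      ((‖x + t • y‖ + (inner ℝ v x - ‖x‖ + t * (b - ‖y‖)) : ℝ) : EReal) := by
    rw [normAdd_le_iff]
    convert hκ.add_le hx' (hκ.smul_le ht.le hy) using 2
    ring
  have h2 := H _ _ h1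
  rw [inner_add_right, inner_smul_right] at h2
  simp only [zero_smul, add_zero]
  linarith

theorem mem_setInv_iff {n : ℕ} {S : E n → Set (E n)} {x y : E n} : x ∈ setInv S y ↔ y ∈ S x :=
  Iff.rfl

/-! ### Polyhedrality of the inverse subdifferential -/

theorem isPolyhedron_of_fintype {n : ℕ} {ι : Type*} [Fintype ι] (a : ι → E n) (b : ι → ℝ) :
    IsPolyhedron {x | ∀ i, inner ℝ (a i) x ≤ b i} := by
  refine ⟨Fintype.card ι, a ∘ (Fintype.equivFin ι).symm, b ∘ (Fintype.equivFin ι).symm, ?_⟩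
  ext x
  exact (Fintype.equivFin ι).symm.forall_congr_right.symm

theorem isPolyhedron_empty {n : ℕ} : IsPolyhedron (∅ : Set (E n)) := by
  convert isPolyhedron_of_fintype (n := n) (ι := Unit) (fun _ => 0) (fun _ => -1) using 1
  ext x
  simp

/-- The set of multiples `t • u` with `t ≥ 0`, for `u` a unit vector, and `{0}` for `u = 0`. -/
theorem isPolyhedron_ray {n : ℕ} (u : E n) :
    IsPolyhedron {x : E n | x = (inner ℝ u x : ℝ) • u ∧ 0 ≤ inner ℝ u x} := by
  -- The index `none` encodes `0 ≤ ⟪u, x⟫`; the pairs `(i, ±)` are the two inequalities making up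
  -- the `i`-th coordinate of `x = ⟪u, x⟫ • u`.
  convert isPolyhedron_of_fintype (n := n) (ι := Option (Fin n × Bool))
    (fun o => o.elim (-u) fun p => (if p.2 then 1 else -1 : ℝ) •
      (EuclideanSpace.single p.1 (1 : ℝ) - u p.1 • u)) (fun _ => 0) using 1
  ext x
  simp only [Set.mem_ofPred_eq, Option.forall, Option.elim, Prod.forall, Bool.forall_bool,
    inner_neg_left, real_inner_smul_left, inner_sub_left, EuclideanSpace.inner_single_left]
  constructor
  · rintro ⟨h1, h2⟩
    refine ⟨by linarith, fun i => ?_⟩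
    have h3 : x i = inner ℝ u x * u i := by
      conv_lhs => rw [h1]
      simp
    simp
    constructor <;> linarith
  · rintro ⟨h1, h2⟩
    refine ⟨?_, by linarith⟩
    ext i
    have := h2 i
    simp at this ⊢
    linarith [this.1, this.2]

theorem eq_inner_smul_of_norm_le_inner {n : ℕ} {u y : E n} (hu : ‖u‖ = 1)
    (h : ‖y‖ ≤ inner ℝ u y) : y = (inner ℝ u y : ℝ) • u := by
  have h1 : inner ℝ u y = ‖y‖ := le_antisymm (by simpa [hu] using real_inner_le_norm u y) h
  rw [h1]
  have := inner_eq_norm_mul_iff_real.1 (show inner ℝ u y = ‖u‖ * ‖y‖ by rw [h1, hu, one_mul])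
  rw [hu, one_smul] at this
  exact this.symm

/-- At any point where `v` is tight, the growth inequality forces equality in Cauchy–Schwarz with `x
/ ‖x‖`. Conversely, tightness passes to nonnegative multiples of `x` by homogeneity. -/
theorem setInv_subdiff_eq_ray {n : ℕ} {κ : E n → EReal} (hκ : IsClosedGauge κ) {x v : E n}
    (hx : x ≠ 0) (hv : v ∈ subdiff (normAdd κ) x) :
    setInv (subdiff (normAdd κ)) v =
      {y : E n | y = (inner ℝ (‖x‖⁻¹ • x) y : ℝ) • (‖x‖⁻¹ • x) ∧ 0 ≤ inner ℝ (‖x‖⁻¹ • x) y} := by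
  have hh := isClosedGauge_normAdd hκ
  obtain ⟨hvx, H⟩ := hh.mem_subdiff_iff.1 hv
  ext y
  constructor
  · intro hy
    obtain ⟨hvy, -⟩ := hh.mem_subdiff_iff.1 (mem_setInv_iff.1 hy)
    have h1 := norm_sub_inner_le_of_mem_subdiff hκ hx hv hvy.le
    have h2 : ‖y‖ ≤ inner ℝ (‖x‖⁻¹ • x) y := by linarith
    exact ⟨eq_inner_smul_of_norm_le_inner (norm_smul_inv_norm (𝕜 := ℝ) hx) h2,
      (norm_nonneg y).trans h2⟩
  · rintro ⟨hy, h0⟩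
    refine mem_setInv_iff.2 (hh.mem_subdiff_iff.2 ⟨?_, H⟩)
    set t : ℝ := inner ℝ (‖x‖⁻¹ • x) y with ht
    have h1 : y = (t * ‖x‖⁻¹) • x := by rw [hy, smul_smul]
    have h2 := hh.smul_le (t := t * ‖x‖⁻¹) (by positivity) hvx.le
    rw [← h1] at h2
    obtain ⟨b, hb⟩ := exists_coe_of_le_coe hh.bot_lt h2
    have h3 := H y b hb.le
    rw [hb, EReal.coe_le_coe_iff] at h2
    have h4 : inner ℝ v y = t * ‖x‖⁻¹ * inner ℝ v x := by
      rw [h1, inner_smul_right]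
    rw [hb, EReal.coe_eq_coe_iff]
    linarith

theorem isPolyhedron_setInv_subdiff_normAdd {n : ℕ} {κ : E n → EReal} (hκ : IsClosedGauge κ)
    (ζ : E n) : IsPolyhedron (setInv (subdiff (normAdd κ)) ζ) := by
  by_cases h : ∃ x ∈ setInv (subdiff (normAdd κ)) ζ, x ≠ 0
  · obtain ⟨x, hx, hx0⟩ := h
    rw [setInv_subdiff_eq_ray hκ hx0 hx]
    exact isPolyhedron_ray _
  · push Not at h
    by_cases h0 : (0 : E n) ∈ setInv (subdiff (normAdd κ)) ζ
    · have : setInv (subdiff (normAdd κ)) ζ = {0} := Set.eq_singleton_iff_unique_mem.2 ⟨h0, h⟩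
      rw [this]
      convert isPolyhedron_ray (0 : E n) using 1
      ext x
      simp
    · have : setInv (subdiff (normAdd κ)) ζ = ∅ := by
        refine Set.eq_empty_of_forall_notMem fun x hx => h0 ?_
        rwa [h x hx] at hx
      rw [this]
      exact isPolyhedron_empty

/-! ### Metric subregularity -/

theorem metricSubregularAt_of_forall {n : ℕ} {S : E n → Set (E n)} {x ζ : E n} {η ρ : ℝ}
    (hζ : ζ ∈ S x) (hη : 0 < η) (hρ : 0 < ρ)
    (H : ∀ y, ‖y - x‖ ≤ ρ → ∀ v ∈ S y, ∃ p ∈ setInv S ζ, ‖y - p‖ ≤ η * ‖v - ζ‖) :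
    MetricSubregularAt S x ζ := by
  refine ⟨hζ, η, ρ, hη, hρ, fun y hy => ?_⟩
  have h0 : ENNReal.ofReal η ≠ 0 := by simpa using hη
  rw [← ENNReal.div_le_iff' h0 ENNReal.ofReal_ne_top, Metric.le_infEDist]
  intro v hv
  obtain ⟨p, hp, hle⟩ := H y (by simpa [dist_eq_norm] using hy) v hv
  rw [ENNReal.div_le_iff' h0 ENNReal.ofReal_ne_top]
  refine (Metric.infEDist_le_edist_of_mem hp).trans ?_
  rw [edist_dist, edist_dist, dist_eq_norm, dist_comm, dist_eq_norm, ← ENNReal.ofReal_mul hη.le]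
  exact ENNReal.ofReal_le_ofReal hle

/-- The residual of the projection onto the ray spanned by a unit vector. -/
theorem norm_sub_ray_sq_le {n : ℕ} {u : E n} (hu : ‖u‖ = 1) (y : E n) :
    ‖y - max (inner ℝ u y) 0 • u‖ ^ 2 ≤ 2 * ‖y‖ * (‖y‖ - inner ℝ u y) := by
  have h1 : inner ℝ u y ≤ ‖y‖ := by simpa [hu] using real_inner_le_norm u y
  rw [norm_sub_sq_real, inner_smul_right, norm_smul, hu, real_inner_comm u y, mul_one,
    Real.norm_eq_abs, sq_abs]
  have h2 := norm_nonneg y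
  rcases le_total (inner ℝ u y) 0 with h | h
  · rw [max_eq_right h]
    nlinarith
  · rw [max_eq_left h]
    nlinarith

/-- A closed gauge that lies above a linear function, strictly so off the origin, lies above it
by a positive multiple of the norm. -/
theorem IsClosedGauge.exists_pos_mul_norm_le {n : ℕ} {κ : E n → EReal} (hκ : IsClosedGauge κ)
    {ζ : E n} (H : ∀ (y : E n) (b : ℝ), y ≠ 0 → κ y ≤ b → inner ℝ ζ y < b) :
    ∃ m : ℝ, 0 < m ∧ ∀ (y : E n) (b : ℝ), κ y ≤ b → m * ‖y‖ ≤ b - inner ℝ ζ y := by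
  by_cases hn : ∃ y : E n, y ≠ 0
  swap
  · push Not at hn
    refine ⟨1, one_pos, fun y b hb => ?_⟩
    have := (hκ.nonneg y).trans hb
    rw [hn y]
    simpa using this
  obtain ⟨z, hz⟩ := hn
  have hlsc : LowerSemicontinuous fun y => ((-inner ℝ ζ y : ℝ) : EReal) + κ y :=
    lowerSemicontinuous_coe_add hκ.closed.2 (by fun_prop)
  obtain ⟨p, hp, hmin⟩ := LowerSemicontinuousOn.exists_isMinOn
    (s := Metric.sphere (0 : E n) 1) ⟨‖z‖⁻¹ • z, by simpa using norm_smul_inv_norm (𝕜 := ℝ) hz⟩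
    (isCompact_sphere _ _) (hlsc.lowerSemicontinuousOn _)
  have hp0 : p ≠ 0 := by
    rintro rfl
    simp at hp
  have hpos : (0 : EReal) < ((-inner ℝ ζ p : ℝ) : EReal) + κ p := by
    rcases eq_or_ne (κ p) ⊤ with htop | htop
    · simp [htop]
    · obtain ⟨b, hb⟩ := exists_coe_of_mem_dom hκ.bot_lt (lt_top_iff_ne_top.2 htop)
      have h1 := H p b hp0 hb.le
      rw [hb]
      have h2 : 0 < -inner ℝ ζ p + b := by linarith
      exact_mod_cast h2
  obtain ⟨m, hm0, hm⟩ := EReal.lt_iff_exists_real_btwn.1 hpos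
  refine ⟨m, by exact_mod_cast hm0, fun y b hb => ?_⟩
  rcases eq_or_ne y 0 with rfl | hy
  · rw [hκ.zero] at hb
    simpa using hb
  have hny : 0 < ‖y‖ := norm_pos_iff.2 hy
  have h1 := hκ.smul_le (inv_nonneg.2 (norm_nonneg y)) hb
  have h2 : ((-inner ℝ ζ p : ℝ) : EReal) + κ p ≤
      ((-inner ℝ ζ (‖y‖⁻¹ • y) : ℝ) : EReal) + κ (‖y‖⁻¹ • y) :=
    hmin (by simpa using norm_smul_inv_norm (𝕜 := ℝ) hy)
  have h3 := hm.le.trans (h2.trans (add_le_add le_rfl h1))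
  rw [← EReal.coe_add, EReal.coe_le_coe_iff, inner_smul_right] at h3
  calc m * ‖y‖ ≤ (-(‖y‖⁻¹ * inner ℝ ζ y) + ‖y‖⁻¹ * b) * ‖y‖ := by gcongr
    _ = b - inner ℝ ζ y := by field_simp; ring

theorem metricSubregularAt_subdiff_normAdd {n : ℕ} {κ : E n → EReal} (hκ : IsClosedGauge κ)
    {x ζ : E n} (hζ : ζ ∈ subdiff (normAdd κ) x) :
    MetricSubregularAt (subdiff (normAdd κ)) x ζ := by
  have hh := isClosedGauge_normAdd hκ
  obtain ⟨hζx, Hζ⟩ := hh.mem_subdiff_iff.1 hζ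
  -- Since `⟪v, ·⟫` minorizes `h` and `ζ` is tight at `p`, one has `⟪v - ζ, p⟫ ≤ 0`. Hence `⟪v - ζ,
  -- y⟫ ≤ ⟪v - ζ, y - p⟫`.
  have gap : ∀ y v p : E n, v ∈ subdiff (normAdd κ) y → ζ ∈ subdiff (normAdd κ) p →
      ∃ b : ℝ, normAdd κ y = b ∧ b - inner ℝ ζ y ≤ ‖v - ζ‖ * ‖y - p‖ := by
    intro y v p hv hp
    obtain ⟨hvy, Hv⟩ := hh.mem_subdiff_iff.1 hv
    obtain ⟨hζp, -⟩ := hh.mem_subdiff_iff.1 hp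
    refine ⟨_, hvy, ?_⟩
    have h1 := Hv p _ hζp.le
    have h2 := real_inner_le_norm (v - ζ) (y - p)
    simp only [inner_sub_left, inner_sub_right] at h2
    linarith
  by_cases h : ∃ x ∈ setInv (subdiff (normAdd κ)) ζ, x ≠ 0
  · obtain ⟨z, hz, hz0⟩ := h
    set u := ‖z‖⁻¹ • z with hu
    have hu1 : ‖u‖ = 1 := norm_smul_inv_norm (𝕜 := ℝ) hz0
    refine metricSubregularAt_of_forall (η := 2 * (‖x‖ + 1)) (ρ := 1) hζ (by positivity) one_pos
      fun y hy v hv => ?_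
    set p : E n := max (inner ℝ u y) 0 • u with hp
    have hpS : p ∈ setInv (subdiff (normAdd κ)) ζ := by
      rw [setInv_subdiff_eq_ray hκ hz0 hz, ← hu]
      have : inner ℝ u p = max (inner ℝ u y) 0 := by
        rw [hp, inner_smul_right, real_inner_self_eq_norm_sq, hu1]; ring
      exact ⟨by rw [this], by rw [this]; exact le_max_right _ _⟩
    refine ⟨p, hpS, ?_⟩
    obtain ⟨b, hb, hgap⟩ := gap y v p hv hpS
    have h1 := norm_sub_inner_le_of_mem_subdiff hκ hz0 hz hb.le
    have h2 := norm_sub_ray_sq_le hu1 y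
    have h3 : ‖y‖ ≤ ‖x‖ + 1 := by
      have := norm_add_le (y - x) x
      rw [sub_add_cancel] at this
      linarith
    -- The estimate is quadratic in `‖y - p‖` on the left and linear on the right; one factor is
    -- cancelled.
    rcases (norm_nonneg (y - p)).eq_or_lt with h0 | h0
    · rw [← h0]; positivity
    · refine le_of_mul_le_mul_right ?_ h0
      calc ‖y - p‖ * ‖y - p‖ = ‖y - p‖ ^ 2 := (sq _).symm
        _ ≤ 2 * ‖y‖ * (‖v - ζ‖ * ‖y - p‖) := h2.trans (by gcongr; linarith)
        _ ≤ 2 * (‖x‖ + 1) * (‖v - ζ‖ * ‖y - p‖) := by gcongr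
        _ = 2 * (‖x‖ + 1) * ‖v - ζ‖ * ‖y - p‖ := by ring
  · push Not at h
    have hx : x = 0 := h x hζ
    subst hx
    -- Now `0` is the only point where `ζ` is tight, so the gap is positive off the origin, and
    -- compactness of the sphere makes it grow linearly.
    obtain ⟨m, hm, Hm⟩ := hh.exists_pos_mul_norm_le (ζ := ζ) fun y b hy hb => by
      refine lt_of_le_of_ne (Hζ y b hb) fun he => hy (h y (mem_setInv_iff.2 (hh.mem_subdiff_iff.2 ⟨?_, Hζ⟩)))
      refine le_antisymm (by rwa [he]) ?_
      obtain ⟨c, hc⟩ := exists_coe_of_le_coe hh.bot_lt hb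
      rw [hc]
      exact_mod_cast Hζ y c hc.le
    refine metricSubregularAt_of_forall (η := m⁻¹) (ρ := 1) hζ (by positivity) one_pos
      fun y hy v hv => ⟨0, hζ, ?_⟩
    obtain ⟨b, hb, hgap⟩ := gap y v 0 hv hζ
    have h1 := Hm y b hb.le
    rw [sub_zero] at hy hgap ⊢
    have h2 : ‖y‖ * m ≤ ‖v - ζ‖ * 1 ∨ ‖y‖ = 0 := by
      rcases (norm_nonneg y).eq_or_lt with h0 | h0
      · exact Or.inr h0.symm
      · refine Or.inl ?_
        have : m * ‖y‖ ≤ ‖v - ζ‖ * ‖y‖ := h1.trans hgap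
        have := le_of_mul_le_mul_right this h0
        nlinarith [norm_nonneg (v - ζ)]
    rcases h2 with h2 | h2
    · rw [inv_mul_eq_div, le_div_iff₀ hm]
      linarith
    · rw [h2]; positivity

/-! ### The exponent `1/2` for convex functions -/

theorem isDesingularizing_const_mul_rpow_half {a₀ : ℝ} (ha : 0 < a₀) :
    IsDesingularizing 1 (fun ν : ℝ => a₀ * ν ^ (1 - 1 / 2 : ℝ)) := by
  have hd : ∀ t : ℝ, 0 < t → HasDerivAt (fun ν : ℝ => a₀ * ν ^ (1 - 1 / 2 : ℝ))
      (a₀ * ((1 - 1 / 2) * t ^ (1 - 1 / 2 - 1 : ℝ))) t := fun t ht =>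
    (Real.hasDerivAt_rpow_const (Or.inl ht.ne')).const_mul a₀
  have hset : {t : ℝ | 0 ≤ t ∧ (t : EReal) < 1} = Set.Ico 0 1 := by
    ext t
    simp only [Set.mem_ofPred_eq, Set.mem_Ico, and_congr_right_iff]
    exact fun _ => by exact_mod_cast Iff.rfl
  refine ⟨by norm_num, fun t ht _ => by positivity, ?_, ?_, ?_, ?_⟩
  · exact (Continuous.continuousOn (by fun_prop (disch := norm_num)))
  · rw [hset]
    have := (Real.concaveOn_rpow (p := 1 - 1 / 2) (by norm_num) (by norm_num)).subset
      Set.Ico_subset_Ici_self (convex_Ico (0 : ℝ) 1)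
    simpa [smul_eq_mul] using this.smul ha.le
  · intro t ht
    exact (contDiffAt_const.mul
      (Real.contDiffAt_rpow_const_of_ne ht.1.ne')).contDiffWithinAt
  · intro t ht _
    rw [(hd t ht).deriv]
    positivity

/-- With `φ ν = (2 / c) * √ν` the derivative is exactly `(c * √ν)⁻¹`, so the KL inequality becomes a
lower bound on the norms of subgradients. The window of values is fixed to `a = 1`. -/
theorem klPropertyExponent_half_of_le_norm {n : ℕ} {f : E n → EReal} {x : E n} {a c : ℝ}
    (hbot : ∀ x, ⊥ < f x) (ha : f x = a) (hc : 0 < c)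
    (H : ∀ᶠ y in 𝓝 x, ∀ ν : ℝ, 0 < ν → ν < 1 → f y = ((a + ν : ℝ) : EReal) →
      ∀ v ∈ subdiff f y, c * √ν ≤ ‖v‖) : KLPropertyExponent f x (1 / 2) := by
  refine ⟨by norm_num, by norm_num, 1, 2 / c, by positivity, one_pos,
    isDesingularizing_const_mul_rpow_half (by positivity), _, H, fun y hy h1 h2 => ?_⟩
  rw [ha] at h1 h2
  obtain ⟨b, hb⟩ := exists_coe_of_mem_dom hbot
    (show y ∈ dom f from lt_of_lt_of_le h2 le_top)
  rw [hb] at h1 h2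
  have h1 : a < b := by exact_mod_cast h1
  have h2 : b < a + 1 := by exact_mod_cast h2
  rw [ha, hb, ← EReal.coe_sub, EReal.toReal_coe]
  set ν := b - a with hν
  have hν0 : 0 < ν := by linarith
  have hder : deriv (fun ν : ℝ => 2 / c * ν ^ (1 - 1 / 2 : ℝ)) ν = (c * √ν)⁻¹ := by
    rw [((Real.hasDerivAt_rpow_const (Or.inl hν0.ne')).const_mul (2 / c)).deriv,
      show (1 - 1 / 2 - 1 : ℝ) = -(1 / 2) by norm_num, Real.rpow_neg hν0.le,
      ← Real.sqrt_eq_rpow]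
    field_simp
    norm_num
  have hpos : 0 < c * √ν := mul_pos hc (Real.sqrt_pos.2 hν0)
  have hinf : ENNReal.ofReal (c * √ν) ≤ Metric.infEDist 0 (subdiff f y) := by
    rw [Metric.le_infEDist]
    intro v hv
    rw [edist_dist, dist_zero_left]
    refine ENNReal.ofReal_le_ofReal (hy ν hν0 (by linarith) ?_ v hv)
    rw [hb, hν]
    congr 1
    ring
  rw [hder]
  calc (1 : ℝ≥0∞) = ENNReal.ofReal (c * √ν)⁻¹ * ENNReal.ofReal (c * √ν) := by
        rw [← ENNReal.ofReal_mul (inv_nonneg.2 hpos.le), inv_mul_cancel₀ hpos.ne',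
          ENNReal.ofReal_one]
    _ ≤ _ := by gcongr

/-- The subgradient inequality tested at the lower point `z` bounds `‖v‖` below by a positive
constant near `x`. Since `ν < 1`, this constant also dominates its product with `√ν`. -/
theorem IsConvex.klPropertyExponent_half_of_not_min {n : ℕ} {f : E n → EReal} (hc : IsConvex f)
    (hbot : ∀ x, ⊥ < f x) {x z : E n} {a b : ℝ} (ha : f x = a) (hz : f z ≤ b) (hba : b < a) :
    KLPropertyExponent f x (1 / 2) := by
  have hR : 0 < ‖z - x‖ + 1 := by positivity
  refine klPropertyExponent_half_of_le_norm (c := (a - b) / (‖z - x‖ + 1)) hbot ha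
    (div_pos (by linarith) hR) ?_
  filter_upwards [Metric.closedBall_mem_nhds x one_pos] with y hy ν hν0 hν1 hfy v hv
  obtain ⟨a', ha', Hv⟩ := (mem_subdiff_iff hbot hc).1 hv
  rw [hfy, EReal.coe_eq_coe_iff] at ha'
  have h1 := Hv z b hz
  have h2 := abs_le.1 (abs_real_inner_le_norm v (z - y))
  have h3 : ‖z - y‖ ≤ ‖z - x‖ + 1 := by
    have h4 : ‖y - x‖ ≤ 1 := by simpa [dist_eq_norm] using hy
    have h5 := norm_sub_le (z - x) (y - x)
    rw [sub_sub_sub_cancel_right] at h5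
    linarith
  have h4 : ‖v‖ * ‖z - y‖ ≤ ‖v‖ * (‖z - x‖ + 1) := by gcongr
  have h5 : √ν ≤ 1 := Real.sqrt_le_one.2 hν1.le
  calc (a - b) / (‖z - x‖ + 1) * √ν ≤ (a - b) / (‖z - x‖ + 1) * 1 := by
        gcongr
    _ ≤ ‖v‖ := by
        rw [mul_one, div_le_iff₀ hR]
        linarith

/-- Quadratic growth at a minimizer of a convex function gives the exponent `1/2`. -/
theorem IsConvex.klPropertyExponent_half_of_growth {n : ℕ} {f : E n → EReal} (hc : IsConvex f)
    (hbot : ∀ x, ⊥ < f x) {x : E n} {a c : ℝ} (ha : f x = a) (hcpos : 0 < c)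
    (H : ∀ᶠ y in 𝓝 x, ∀ b : ℝ, f y ≤ b → c * ‖y - x‖ ^ 2 ≤ b - a) :
    KLPropertyExponent f x (1 / 2) := by
  refine klPropertyExponent_half_of_le_norm (c := √c) hbot ha (Real.sqrt_pos.2 hcpos) ?_
  filter_upwards [H] with y hy ν hν0 _ hfy v hv
  obtain ⟨a', ha', Hv⟩ := (mem_subdiff_iff hbot hc).1 hv
  rw [hfy, EReal.coe_eq_coe_iff] at ha'
  have h1 := Hv x a ha.le
  have h2 := abs_le.1 (abs_real_inner_le_norm v (x - y))
  rw [norm_sub_rev] at h2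
  have h3 := hy _ hfy.le
  have h4 : ν ≤ ‖v‖ * ‖y - x‖ := by linarith
  have h5 : c * ‖y - x‖ ^ 2 ≤ ν := by linarith
  have h6 : √c * ‖y - x‖ ≤ √ν := by
    refine Real.le_sqrt_of_sq_le ?_
    rwa [mul_pow, Real.sq_sqrt hcpos.le]
  have hν : 0 < √ν := Real.sqrt_pos.2 hν0
  -- Convexity gives `ν ≤ ‖v‖ * ‖y - x‖` and growth gives `‖y - x‖ ≤ √(ν / c)`; eliminating `‖y -
  -- x‖` leaves the square root.
  refine le_of_mul_le_mul_right ?_ hν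
  calc √c * √ν * √ν = √c * ν := by rw [mul_assoc, Real.mul_self_sqrt hν0.le]
    _ ≤ √c * (‖v‖ * ‖y - x‖) := by gcongr
    _ = ‖v‖ * (√c * ‖y - x‖) := by ring
    _ ≤ ‖v‖ * √ν := by gcongr

/-! ### Lagrange multipliers -/

/-- This set is a union of open quadrants, hence open for arbitrary `h` and `g`. Multipliers can
thus be found by separating a point from an open convex set in the plane. -/
theorem isOpen_setOf_value_lt {n : ℕ} (h : E n → EReal) (g : E n → ℝ) :
    IsOpen {p : ℝ × ℝ | ∃ (y : E n) (b : ℝ), h y ≤ b ∧ b < p.1 ∧ g y < p.2} := by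
  simp only [Set.ofPred_exists]
  refine isOpen_iUnion fun y => isOpen_iUnion fun b => ?_
  by_cases hb : h y ≤ b
  · simp only [hb, true_and]
    exact (isOpen_lt continuous_const continuous_fst).inter
      (isOpen_lt continuous_const continuous_snd)
  · simp [hb]

theorem convex_setOf_value_lt {n : ℕ} {h : E n → EReal} (hc : IsConvex h) {g : E n → ℝ}
    (hg : ConvexOn ℝ Set.univ g) :
    Convex ℝ {p : ℝ × ℝ | ∃ (y : E n) (b : ℝ), h y ≤ b ∧ b < p.1 ∧ g y < p.2} := by
  rw [convex_iff_forall_pos]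
  rintro p ⟨y, b, hy, hb, hgy⟩ p' ⟨y', b', hy', hb', hgy'⟩ s t hs ht hst
  refine ⟨s • y + t • y', s * b + t * b', hc.combo_le hy hy' hs.le ht.le hst, ?_, ?_⟩
  · simp only [Prod.fst_add, Prod.smul_fst, smul_eq_mul]
    gcongr
  · refine (hg.2 trivial trivial hs.le ht.le hst).trans_lt ?_
    simp only [Prod.snd_add, Prod.smul_snd, smul_eq_mul]
    gcongr

/-- Existence of a Lagrange multiplier for one convex inequality constraint under Slater's
condition. -/
theorem exists_lagrange_multiplier {n : ℕ} {h : E n → EReal} (hc : IsConvex h) {g : E n → ℝ}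
    (hg : ConvexOn ℝ Set.univ g) {a : ℝ}
    (hmin : ∀ (y : E n) (b : ℝ), h y ≤ b → g y ≤ 0 → a ≤ b)
    {x₀ : E n} {b₀ : ℝ} (hx₀ : h x₀ ≤ b₀) (hg₀ : g x₀ < 0) :
    ∃ μ : ℝ, 0 ≤ μ ∧ ∀ (y : E n) (b : ℝ), h y ≤ b → a ≤ b + μ * g y := by
  set K := {p : ℝ × ℝ | ∃ (y : E n) (b : ℝ), h y ≤ b ∧ b < p.1 ∧ g y < p.2} with hK
  have hnot : ((a, 0) : ℝ × ℝ) ∉ K := by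
    rintro ⟨y, b, hy, hb, hgy⟩
    exact absurd (hmin y b hy hgy.le) (not_le.2 hb)
  obtain ⟨f, hf⟩ := geometric_hahn_banach_open_point (convex_setOf_value_lt hc hg)
    (isOpen_setOf_value_lt h g) hnot
  set α := f (1, 0) with hα
  set β := f (0, 1) with hβ
  have hfp : ∀ s t : ℝ, f (s, t) = s * α + t * β := by
    intro s t
    have : ((s, t) : ℝ × ℝ) = s • (1, 0) + t • (0, 1) := by simp
    rw [this, map_add, map_smul, map_smul, smul_eq_mul, smul_eq_mul]
  have key : ∀ (y : E n) (b s t : ℝ), h y ≤ b → b < s → g y < t → (s - a) * α + t * β < 0 := by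
    intro y b s t hy hs ht
    have := hf (s, t) ⟨y, b, hy, hs, ht⟩
    rw [hfp, hfp] at this
    linarith
  -- The set is unbounded upwards in the constraint coordinate, so a positive `β` would violate the
  -- separation.
  have hβ0 : β ≤ 0 := by
    by_contra hpos
    push Not at hpos
    have h1 := key x₀ b₀ (b₀ + 1) (|(b₀ + 1 - a) * α| / β) hx₀ (by linarith)
      (hg₀.trans_le (by positivity))
    rw [div_mul_cancel₀ _ hpos.ne'] at h1
    linarith [neg_abs_le ((b₀ + 1 - a) * α)]
  -- Slater's condition excludes a vertical separating line: for `α ≥ 0`, a point with negative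
  -- constraint coordinate contradicts `β ≤ 0`.
  have hα0 : α < 0 := by
    by_contra hpos
    push Not at hpos
    have h1 := key x₀ b₀ (max (b₀ + 1) a) (g x₀ / 2) hx₀
      (lt_of_lt_of_le (by linarith) (le_max_left _ _)) (by linarith)
    have h2 : 0 ≤ (max (b₀ + 1) a - a) * α :=
      mul_nonneg (sub_nonneg.2 (le_max_right _ _)) hpos
    nlinarith
  refine ⟨β / α, div_nonneg_of_nonpos hβ0 hα0.le, fun y b hy => ?_⟩
  have h1 : (b - a) * α + g y * β ≤ 0 := by
    by_contra hpos
    push Not at hpos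
    -- Both coordinates are shifted by the amount that brings the functional to exactly `0`,
    -- contradicting strict separation.
    have hk : 0 < -(α + β) := by linarith
    have hε := div_pos hpos hk
    have h2 := key y b (b + _) (g y + _) hy (lt_add_of_pos_right b hε)
      (lt_add_of_pos_right (g y) hε)
    have h3 := div_mul_cancel₀ ((b - a) * α + g y * β) hk.ne'
    nlinarith
  have h2 : β / α * g y = g y * β / α := by ring
  have h3 : 0 ≤ ((b - a) * α + g y * β) / α := div_nonneg_of_nonpos h1 hα0.le
  rw [add_div, mul_div_cancel_right₀ _ hα0.ne] at h3
  linarith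

/-! ### The constrained problem -/

theorem constrainedFn_le_iff {n s : ℕ} {h : E n → EReal} {q : E s → ℝ}
    {A : Matrix (Fin s) (Fin n) ℝ} (hbot : ∀ x, ⊥ < h x) {x : E n} {b : ℝ} :
    constrainedFn h q A x ≤ b ↔ h x ≤ b ∧ q (Matrix.toEuclideanLin A x) ≤ 0 := by
  unfold constrainedFn indicatorFn
  by_cases hx : x ∈ constraintSet q A
  · have hx' : q (Matrix.toEuclideanLin A x) ≤ 0 := hx
    simp [hx, hx']
  · have hx' : ¬ q (Matrix.toEuclideanLin A x) ≤ 0 := hx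
    simp [hx, hx', EReal.add_top_of_ne_bot (hbot x).ne']

/-- Any two points lie in a common closed ball about `0`, where strong convexity is available. -/
theorem StronglyConvexOnCompacts.convexOn {s : ℕ} {q : E s → ℝ}
    (hq : StronglyConvexOnCompacts q) : ConvexOn ℝ Set.univ q := by
  refine ⟨convex_univ, fun x _ y _ a b ha hb hab => ?_⟩
  obtain ⟨σ, hσ, H⟩ := hq (Metric.closedBall 0 (max ‖x‖ ‖y‖)) (isCompact_closedBall _ _)
    (convex_closedBall _ _)
  have := H.2 (x := x) (by simp) (y := y) (by simp) ha hb hab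
  have h2 : 0 ≤ a * b * (σ / 2 * ‖x - y‖ ^ 2) := by positivity
  linarith

theorem isConvex_constrainedFn {n s : ℕ} {h : E n → EReal} {q : E s → ℝ}
    {A : Matrix (Fin s) (Fin n) ℝ} (hbot : ∀ x, ⊥ < h x) (hc : IsConvex h)
    (hq : ConvexOn ℝ Set.univ q) : IsConvex (constrainedFn h q A) := by
  refine isConvex_of_combo_le fun x y a b t r hx hy ht hr htr => ?_
  rw [constrainedFn_le_iff hbot] at *
  refine ⟨hc.combo_le hx.1 hy.1 ht hr htr, ?_⟩
  rw [map_add, map_smul, map_smul]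
  refine (hq.2 trivial trivial ht hr htr).trans ?_
  simp only [smul_eq_mul]
  nlinarith [hx.2, hy.2]

theorem bot_lt_constrainedFn {n s : ℕ} {h : E n → EReal} {q : E s → ℝ}
    {A : Matrix (Fin s) (Fin n) ℝ} (hbot : ∀ x, ⊥ < h x) (x : E n) :
    ⊥ < constrainedFn h q A x := by
  refine EReal.bot_lt_add_iff.2 ⟨hbot x, ?_⟩
  unfold indicatorFn
  split_ifs <;> simp

theorem isProperClosed_constrainedFn {n s : ℕ} {h : E n → EReal} {q : E s → ℝ}
    {A : Matrix (Fin s) (Fin n) ℝ} (hh : IsProperClosed h) (hq : Continuous q)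
    (hx : ∃ x ∈ dom h, q (Matrix.toEuclideanLin A x) ≤ 0) :
    IsProperClosed (constrainedFn h q A) := by
  obtain ⟨x, hx, hqx⟩ := hx
  refine ⟨⟨bot_lt_constrainedFn hh.1.1, x, ?_⟩, ?_⟩
  · obtain ⟨a, ha⟩ := exists_coe_of_mem_dom hh.1.1 hx
    exact lt_of_le_of_lt ((constrainedFn_le_iff hh.1.1).2 ⟨ha.le, hqx⟩) (EReal.coe_lt_top a)
  · have hcl : IsClosed (constraintSet q A) :=
      isClosed_le (hq.comp (LinearMap.continuous_of_finiteDimensional _)) continuous_const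
    intro y c hc
    by_cases hy : y ∈ constraintSet q A
    · have h1 : c < h y := by simpa [constrainedFn, indicatorFn, hy] using hc
      filter_upwards [hh.2 y c h1] with z hz
      refine hz.trans_le (le_add_of_nonneg_right ?_)
      unfold indicatorFn
      split_ifs <;> simp
    · filter_upwards [hcl.isOpen_compl.mem_nhds hy] with z hz
      have hz' : z ∉ constraintSet q A := hz
      have h1 : ∀ w, w ∉ constraintSet q A → constrainedFn h q A w = ⊤ := fun w hw => by
        simp [constrainedFn, indicatorFn, hw, EReal.add_top_of_ne_bot (hh.1.1 w).ne']
      rw [h1 y hy] at hc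
      rwa [h1 z hz']

/-- The first-order form of strong convexity, obtained by differentiating its defining inequality
along the segment at `p`. -/
theorem _root_.StrongConvexOn.add_fderiv_add_sq_le {s : ℕ} {C : Set (E s)} {σ : ℝ} {q : E s → ℝ}
    (hq : StrongConvexOn C σ q) {p z : E s} (hp : p ∈ C) (hz : z ∈ C) {D : E s →L[ℝ] ℝ}
    (hD : HasFDerivAt q D p) : q p + D (z - p) + σ / 2 * ‖z - p‖ ^ 2 ≤ q z := by
  have h1 : HasDerivAt (fun t : ℝ => p + t • (z - p)) (z - p) 0 := by
    simpa using ((hasDerivAt_id (0 : ℝ)).smul_const (z - p)).const_add p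
  have h2 : HasDerivAt (fun t : ℝ => q (p + t • (z - p))) (D (z - p)) 0 :=
    HasFDerivAt.comp_hasDerivAt (0 : ℝ) (by simpa using hD) h1
  have h3 : HasDerivAt (fun t : ℝ => -q (p + t • (z - p)) + t ^ 2 * (σ / 2 * ‖z - p‖ ^ 2))
      (-D (z - p)) 0 := by
    have h4 := h2.fun_neg.fun_add
      ((hasDerivAt_pow 2 (0 : ℝ)).mul_const (σ / 2 * ‖z - p‖ ^ 2))
    exact h4.congr_deriv (by simp)
  have key := nonneg_add_deriv_of_le (c := q z - q p - σ / 2 * ‖z - p‖ ^ 2) h3 ?_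
  · linarith
  intro t ht ht1
  have h4 := hq.2 hp hz (sub_nonneg.2 ht1) ht.le (by ring)
  have h5 : (1 - t) • p + t • z = p + t • (z - p) := by module
  rw [h5, norm_sub_rev] at h4
  simp only [smul_eq_mul] at h4
  simp only [zero_smul, add_zero]
  linarith

/-- Closeness to a ray together with closeness of the images under a linear map that does not
vanish on the ray controls the distance to a point of the ray. -/
theorem exists_mul_norm_sub_sq_le {n s : ℕ} (T : E n →L[ℝ] E s) {u x : E n} (hu : ‖u‖ = 1)
    (hx : x = ‖x‖ • u) (hT : T u ≠ 0) {k R : ℝ} (hk : 0 < k) (hR : 0 < R) :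
    ∃ c : ℝ, 0 < c ∧ ∀ z : E n, ‖z‖ ≤ R →
      c * ‖z - x‖ ^ 2 ≤ ‖z‖ - inner ℝ u z + k * ‖T (z - x)‖ ^ 2 := by
  have hμ : 0 < ‖T u‖ := norm_pos_iff.2 hT
  set μ := ‖T u‖ with hμdef
  set M := ‖T‖ with hM
  set B₁ := (4 * M ^ 2 / μ ^ 2 + 2) * (2 * R) with hB₁
  set B₂ := 4 / μ ^ 2 / k with hB₂
  have hB₁0 : 0 < B₁ := by positivity
  have hB₂0 : 0 < B₂ := by positivity
  refine ⟨(B₁ + B₂)⁻¹, by positivity, fun z hz => ?_⟩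
  rw [inv_mul_le_iff₀ (by positivity)]
  set r := inner ℝ u z with hr
  set e := z - r • u with he
  set d := r - ‖x‖ with hd
  set τ := ‖T (z - x)‖ with hτ
  have hrz : r ≤ ‖z‖ := by simpa [hu] using real_inner_le_norm u z
  have hrz' : -‖z‖ ≤ r := by simpa [hu] using (abs_le.1 (abs_real_inner_le_norm u z)).1
  have he2 : ‖e‖ ^ 2 ≤ 2 * R * (‖z‖ - r) := by
    have : ‖e‖ ^ 2 = (‖z‖ + r) * (‖z‖ - r) := by
      rw [he, norm_sub_sq_real, inner_smul_right, norm_smul, hu, real_inner_comm u z, ← hr,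
        mul_one, Real.norm_eq_abs, sq_abs]
      ring
    rw [this]
    exact mul_le_mul_of_nonneg_right (by linarith) (by linarith)
  -- Here `e` is the part orthogonal to the ray, with `‖e‖ ^ 2` controlled by `‖z‖ - r`. The part
  -- `d` along it is recovered from `d • T u = T (z - x) - T e`.
  have hzx : z - x = d • u + e := by
    rw [he, hd, sub_smul, ← hx]; abel
  have h1 : |d| * μ ≤ τ + M * ‖e‖ := by
    have h2 : d • T u = T (z - x) - T e := by rw [hzx, map_add, map_smul]; abel
    have h3 := norm_sub_le (T (z - x)) (T e)
    rw [← h2, norm_smul, Real.norm_eq_abs] at h3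
    exact h3.trans (by gcongr; exact T.le_opNorm e)
  have h2 : d ^ 2 * μ ^ 2 ≤ 2 * τ ^ 2 + 2 * (M ^ 2 * ‖e‖ ^ 2) := by
    have h3 : (|d| * μ) ^ 2 ≤ (τ + M * ‖e‖) ^ 2 := by gcongr
    rw [mul_pow, sq_abs] at h3
    nlinarith [sq_nonneg (τ - M * ‖e‖)]
  have h3 : d ^ 2 ≤ (2 * τ ^ 2 + 2 * (M ^ 2 * ‖e‖ ^ 2)) / μ ^ 2 := by
    rwa [le_div_iff₀ (by positivity)]
  have h4 : ‖z - x‖ ^ 2 ≤ 2 * d ^ 2 + 2 * ‖e‖ ^ 2 := by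
    have h5 := norm_add_le (d • u) e
    rw [← hzx, norm_smul, hu, mul_one, Real.norm_eq_abs] at h5
    have h6 : ‖z - x‖ ^ 2 ≤ (|d| + ‖e‖) ^ 2 := by gcongr
    nlinarith [sq_nonneg (|d| - ‖e‖), sq_abs d]
  calc ‖z - x‖ ^ 2
      ≤ 2 * ((2 * τ ^ 2 + 2 * (M ^ 2 * ‖e‖ ^ 2)) / μ ^ 2) + 2 * ‖e‖ ^ 2 := by linarith
    _ = (4 * M ^ 2 / μ ^ 2 + 2) * ‖e‖ ^ 2 + B₂ * (k * τ ^ 2) := by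
        rw [hB₂]; field_simp; ring
    _ ≤ (4 * M ^ 2 / μ ^ 2 + 2) * (2 * R * (‖z‖ - r)) + B₂ * (k * τ ^ 2) := by gcongr
    _ = B₁ * (‖z‖ - r) + B₂ * (k * τ ^ 2) := by rw [hB₁]; ring
    _ ≤ (B₁ + B₂) * (‖z‖ - r + k * τ ^ 2) := by
        have h5 : 0 ≤ B₁ * (k * τ ^ 2) := by positivity
        have h6 : 0 ≤ B₂ * (‖z‖ - r) := mul_nonneg hB₂0.le (by linarith)
        linarith

theorem norm_le_of_normAdd_le {n : ℕ} {κ : E n → EReal} (hκ : IsClosedGauge κ) {x : E n} {b : ℝ}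
    (hx : normAdd κ x ≤ b) : ‖x‖ ≤ b := by
  have h1 := (hκ.nonneg x).trans (normAdd_le_iff.1 hx)
  have h2 : 0 ≤ b - ‖x‖ := by exact_mod_cast h1
  linarith

/-- Quadratic growth of the constrained objective at a minimizer. -/
theorem exists_growth_of_isMin {n s : ℕ} {κ : E n → EReal} (hκ : IsClosedGauge κ)
    {q : E s → ℝ} {A : Matrix (Fin s) (Fin n) ℝ} (hq : StronglyConvexOnCompacts q)
    (hdiff : Differentiable ℝ q)
    (hslater : ∃ x ∈ dom (normAdd κ), q (Matrix.toEuclideanLin A x) < 0) (hq0 : 0 < q 0)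
    {x : E n} {a : ℝ} (hx : normAdd κ x = a) (hqx : q (Matrix.toEuclideanLin A x) ≤ 0)
    (hmin : ∀ (y : E n) (b : ℝ), normAdd κ y ≤ b → q (Matrix.toEuclideanLin A y) ≤ 0 → a ≤ b) :
    ∃ c : ℝ, 0 < c ∧ ∀ᶠ y in 𝓝 x, ∀ b : ℝ, constrainedFn (normAdd κ) q A y ≤ b →
      c * ‖y - x‖ ^ 2 ≤ b - a := by
  have hh := isClosedGauge_normAdd hκ
  set T : E n →L[ℝ] E s := LinearMap.toContinuousLinearMap (Matrix.toEuclideanLin A) with hT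
  have hTA : ∀ y, Matrix.toEuclideanLin A y = T y := fun _ => rfl
  simp only [hTA] at hslater hqx hmin
  have hTx : T x ≠ 0 := fun h0 => absurd hqx (not_le.2 (by rwa [h0]))
  have hx0 : x ≠ 0 := by
    rintro rfl
    exact hTx (map_zero T)
  have hapos : 0 < a := (norm_pos_iff.2 hx0).trans_le (norm_le_of_normAdd_le hκ hx.le)
  obtain ⟨x₀, hx₀, hq₀⟩ := hslater
  obtain ⟨b₀, hb₀⟩ := exists_coe_of_mem_dom hh.bot_lt hx₀
  obtain ⟨μ, hμ, hL⟩ := exists_lagrange_multiplier (g := fun y => q (T y)) hh.convex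
    (hq.convexOn.comp_linearMap T.toLinearMap) hmin hb₀.le hq₀
  -- The multiplier inequality at the origin reads `a ≤ μ * q 0`, and `a > 0`.
  have hμpos : 0 < μ := by
    refine lt_of_le_of_ne hμ fun h0 => ?_
    have := hL 0 0 (by simp [hh.zero])
    rw [← h0] at this
    linarith
  have hqx0 : q (T x) = 0 := by
    refine le_antisymm hqx (le_of_mul_le_mul_left ?_ hμpos)
    have := hL x a hx.le
    linarith
  set D := fderiv ℝ q (T x) with hD
  have hDx : HasFDerivAt q D (T x) := (hdiff _).hasFDerivAt
  -- The vector `-μ Tᵀ∇q(T x)`: stationarity of the Lagrangian at `x` makes it a subgradient of `h`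
  -- there.
  set v : E n := (InnerProductSpace.toDual ℝ (E n)).symm (-(μ • D.comp T)) with hvdef
  have hv : ∀ y, inner ℝ v y = -(μ * D (T y)) := fun y => by
    rw [hvdef, InnerProductSpace.toDual_symm_apply]
    rfl
  have hvsub : v ∈ subdiff (normAdd κ) x := by
    refine (mem_subdiff_iff hh.bot_lt hh.convex).2 ⟨a, hx, fun y b hb => ?_⟩
    have h1 : HasDerivAt (fun t : ℝ => T (x + t • (y - x))) (T (y - x)) 0 := by
      have : HasDerivAt (fun t : ℝ => x + t • (y - x)) (y - x) 0 := by
        simpa using ((hasDerivAt_id (0 : ℝ)).smul_const (y - x)).const_add x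
      exact T.hasFDerivAt.comp_hasDerivAt (0 : ℝ) this
    have h2 : HasDerivAt (fun t : ℝ => μ * q (T (x + t • (y - x)))) (μ * D (T (y - x))) 0 :=
      (HasFDerivAt.comp_hasDerivAt (0 : ℝ) (by simpa using hDx) h1).const_mul μ
    have key := nonneg_add_deriv_of_le (c := b - a) h2 ?_
    · rw [hv]
      linarith
    intro t ht ht1
    have h3 := hL _ _ (hh.convex.line_le hx.le hb ht.le ht1)
    simp only [zero_smul, add_zero, hqx0, mul_zero]
    linarith
  set u := ‖x‖⁻¹ • x with hu
  have hnx : ‖x‖ ≠ 0 := norm_ne_zero_iff.2 hx0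
  have hu1 : ‖u‖ = 1 := norm_smul_inv_norm (𝕜 := ℝ) hx0
  have hxu : x = ‖x‖ • u := by rw [hu, smul_inv_smul₀ hnx]
  have hTu : T u ≠ 0 := by
    rw [hu, map_smul]
    exact smul_ne_zero (inv_ne_zero hnx) hTx
  -- This ball contains the image under `T` of the unit ball about `x`.
  obtain ⟨σ, hσ, hstrong⟩ := hq (Metric.closedBall (T x) (‖T‖ * 1)) (isCompact_closedBall _ _)
    (convex_closedBall _ _)
  obtain ⟨c, hc, hgrow⟩ := exists_mul_norm_sub_sq_le T hu1 hxu hTu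
    (k := μ * (σ / 2)) (R := ‖x‖ + 1) (by positivity) (by positivity)
  refine ⟨c, hc, ?_⟩
  filter_upwards [Metric.closedBall_mem_nhds x one_pos] with y hy b hb
  rw [constrainedFn_le_iff hh.bot_lt, hTA] at hb
  have hyx : ‖y - x‖ ≤ 1 := by simpa [dist_eq_norm] using hy
  have hyR : ‖y‖ ≤ ‖x‖ + 1 := by
    have := norm_add_le (y - x) x
    rw [sub_add_cancel] at this
    linarith
  have hTy : T y ∈ Metric.closedBall (T x) (‖T‖ * 1) := by
    rw [Metric.mem_closedBall, dist_eq_norm, ← map_sub]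
    exact (T.le_opNorm _).trans (by gcongr)
  have h1 := hstrong.add_fderiv_add_sq_le (Metric.mem_closedBall_self (by positivity)) hTy hDx
  rw [hqx0, ← map_sub] at h1
  have h2 := norm_sub_inner_le_of_mem_subdiff hκ hx0 hvsub hb.1
  have h3 : a = inner ℝ v x := by
    have := (hh.mem_subdiff_iff.1 hvsub).1
    rw [hx] at this
    exact_mod_cast this
  have h4 := hv (y - x)
  rw [inner_sub_right] at h4
  -- Feasibility of `y` and activity at `x` give `⟪v, y - x⟫ ≥ μ * (σ / 2) * ‖T (y - x)‖ ^ 2`, the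
  -- extra term that is added to `‖y‖ - ⟪u, y⟫`.
  have h5 : μ * (D (T (y - x)) + σ / 2 * ‖T (y - x)‖ ^ 2) ≤ 0 :=
    mul_nonpos_of_nonneg_of_nonpos hμ (by linarith [hb.2])
  have h6 := hgrow y hyR
  rw [← hu] at h2
  linarith

theorem isKLFunctionExponent_half_constrainedFn {n s : ℕ} {κ : E n → EReal}
    (hκ : IsClosedGauge κ) {q : E s → ℝ} {A : Matrix (Fin s) (Fin n) ℝ}
    (hq : StronglyConvexOnCompacts q) (hdiff : Differentiable ℝ q)
    (hslater : ∃ x ∈ dom (normAdd κ), q (Matrix.toEuclideanLin A x) < 0)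
    (h0 : (0 : E n) ∉ dom (normAdd κ) ∩ constraintSet q A) :
    IsKLFunctionExponent (constrainedFn (normAdd κ) q A) (1 / 2) := by
  have hh := isClosedGauge_normAdd hκ
  have hq0 : 0 < q 0 := by
    by_contra hle
    push Not at hle
    exact h0 ⟨by simp [dom, hh.zero], by simpa [constraintSet] using hle⟩
  have hbot : ∀ x, ⊥ < constrainedFn (normAdd κ) q A x := bot_lt_constrainedFn hh.bot_lt
  have hconv := isConvex_constrainedFn (A := A) hh.bot_lt hh.convex hq.convexOn
  refine ⟨isProperClosed_constrainedFn hh.closed hdiff.continuous ?_, ?_⟩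
  · obtain ⟨x, hx, hqx⟩ := hslater
    exact ⟨x, hx, hqx.le⟩
  rintro x ⟨w, hw⟩
  obtain ⟨a, ha, -⟩ := (mem_subdiff_iff hbot hconv).1 hw
  by_cases hmin : ∀ (y : E n) (b : ℝ), constrainedFn (normAdd κ) q A y ≤ b → a ≤ b
  · obtain ⟨hx, hqx⟩ := (constrainedFn_le_iff hh.bot_lt).1 ha.le
    have hxa : normAdd κ x = a := by
      refine le_antisymm hx ?_
      obtain ⟨a', ha'⟩ := exists_coe_of_le_coe hh.bot_lt hx
      rw [ha', EReal.coe_le_coe_iff]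
      exact hmin x a' ((constrainedFn_le_iff hh.bot_lt).2 ⟨ha'.le, hqx⟩)
    obtain ⟨c, hc, hgrow⟩ := exists_growth_of_isMin hκ hq hdiff hslater hq0 hxa hqx
      fun y b hy hqy => hmin y b ((constrainedFn_le_iff hh.bot_lt).2 ⟨hy, hqy⟩)
    exact hconv.klPropertyExponent_half_of_growth hbot ha hc hgrow
  · push Not at hmin
    obtain ⟨z, b, hz, hba⟩ := hmin
    exact hconv.klPropertyExponent_half_of_not_min hbot ha hz hba

end KLExp

theorem mainTheorem3 {n : ℕ} (κ : KLExp.E n → EReal) (hκ : KLExp.IsClosedGauge κ) :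
    (∀ ζ : KLExp.E n,
      KLExp.IsPolyhedron (KLExp.setInv (KLExp.subdiff (KLExp.normAdd κ)) ζ)) ∧
    (∀ x ∈ KLExp.setDom (KLExp.subdiff (KLExp.normAdd κ)),
      ∀ ζ ∈ KLExp.subdiff (KLExp.normAdd κ) x,
        KLExp.MetricSubregularAt (KLExp.subdiff (KLExp.normAdd κ)) x ζ) ∧
    (∀ (s : ℕ) (q : KLExp.E s → ℝ) (A : Matrix (Fin s) (Fin n) ℝ),
      KLExp.StronglyConvexOnCompacts q →
      ContDiff ℝ 2 q →
      BddBelow (Set.range q) →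
      (∃ x ∈ KLExp.dom (KLExp.normAdd κ), q (Matrix.toEuclideanLin A x) < 0) →
      (0 : KLExp.E n) ∉ KLExp.dom (KLExp.normAdd κ) ∩ KLExp.constraintSet q A →
      KLExp.IsKLFunctionExponent (KLExp.constrainedFn (KLExp.normAdd κ) q A) (1 / 2)) := by
  refine ⟨KLExp.isPolyhedron_setInv_subdiff_normAdd hκ,
    fun x _ ζ hζ => KLExp.metricSubregularAt_subdiff_normAdd hκ hζ,
    fun s q A hq hq2 _ hslater h0 => ?_⟩
  exact KLExp.isKLFunctionExponent_half_constrainedFn hκ hq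
    (hq2.differentiable (by norm_num)) hslater h0
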